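/- **Setting.** Let $\mathcal A$ be a set of particles with a real symmetric positive (i.e. positive semidefinite) interaction matrix $(L(\alpha,\beta))_{\alpha,\beta\in\mathcal A}$. Let $\mathcal C$ be a finite set of channels, where each channel $\nu\in\mathcal C$ is a sequence $(\nu(k))_{k\ge 0}$ of points of $\mathcal A$, such that: * the points $\nu(k)$, $\nu\in\mathcal C$, $k\ge1$, are pairwise distinct and different from all points $\sigma(0)$, $\sigma\in\mathcal C$ (the points $\sigma(0)$ need not be distinct); * $L(\nu(k),\nu(k+1))\ne0$ for all $k\ge0$, and for $k\ge 1$ we have $L(\nu(k),\alpha)=0$ unless $\alpha\in\{\nu(k-1),\nu(k),\nu(k+1)\}$; * there is $K_0>0$ such that $L(\nu(k),\nu(k))=2$ and $L(\nu(k),\nu(k+1))=-1$ for all $\nu\in\mathcal C$ and $k\ge K_0$; * the set $\mathcal A_1=\mathcal A\setminus\{\nu(k):\nu\in\mathcal C,\ k\ge1\}$ is finite. Put $\mathcal F=\mathcal A_1\cup\{\nu(1):\nu\in\mathcal C\}$, a finite graph in which $\alpha\ne\beta$ are joined by an edge iff $L(\alpha,\beta)\ne0$. If $\mathcal B\subset\mathcal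 F$ and some $\beta\in\mathcal B$ has exactly one neighbour $\alpha$ in $\mathcal F\setminus\mathcal B$, then $\mathcal B\cup\{\alpha\}$ is called an extension of $\mathcal B$. Iterating extensions until no further extension exists leads to a set that depends only on $\mathcal B$; it is called the maximal extension of $\mathcal B$ and denoted by $[\mathcal B]$. **Corollary 4.6.** Let $u\in C^1([0,1],\ell^2(\mathcal A))$ be a solution of $$\partial_t u(t,\alpha)=\mathrm i\sum_{\beta\in\mathcal A}L(\alpha,\beta)\,u(t,\beta),\qquad t\in[0,1],\ \alpha\in\mathcal A,$$ and let $\nu_0\in\mathcal C$. Suppose that for every $\nu\in\mathcal C\setminus\{\nu_0\}$ there are $\varepsilon>0$ and $C$ such that $$|u(t,\nu(k))|\le C\Big(\frac{\mathrm e}{(2+\varepsilon)k}\Big)^k,\qquad k>0,\quad t\in\{0,1\}.$$ Suppose in addition that $[\mathcal B]=\mathcal F$, where $\mathcal B=\{\nu(0),\nu(1):\nu\in\mathcal C\setminus\{\nu_0\}\}$. Then $u(t,\alpha)=0$ for all $\alpha\in\mathcal A$ and $t\in[0,1]$. -/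

import Mathlib

open scoped ENNReal

/-! ### Extensions of a set of vertices in a finite graph -/

section Extension

variable {V : Type*}

/-- `T` is a (one-step) extension of `S`: some vertex `β` of `S` has exactly one neighbour `α`
outside `S`, and `T = S ∪ {α}`. -/
def IsExtension (G : SimpleGraph V) (S T : Set V) : Prop :=
  ∃ β ∈ S, ∃ α, (α ∉ S ∧ G.Adj α β) ∧ (∀ α', α' ∉ S ∧ G.Adj α' β → α' = α) ∧ T = S ∪ {α}

/-- A maximal chain of prolongations that begins at `S` ends at `T`: `T` is reached from `S` by
finitely many one-step extensions, and `T` has no extension itself. -/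
def IsMaximalExtension (G : SimpleGraph V) (S T : Set V) : Prop :=
  Relation.ReflTransGen (IsExtension G) S T ∧ ∀ T', ¬ IsExtension G T T'

theorem IsMaximalExtension.subset_of_chain {G : SimpleGraph V} {S T X : Set V}
    (hT : IsMaximalExtension G S T) (hX : Relation.ReflTransGen (IsExtension G) S X) :
    X ⊆ T := by
  have mono : ∀ {Y : Set V}, Relation.ReflTransGen (IsExtension G) S Y → S ⊆ Y := by
    intro Y hY
    induction hY with
    | refl => exact subset_rfl
    | tail _ h ih =>
      obtain ⟨_, _, _, _, _, rfl⟩ := h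
      exact ih.trans Set.subset_union_left
  induction hX with
  | refl => exact mono hT.1
  | tail _ h ih =>
    obtain ⟨β, hβ, α, ⟨_, hadj⟩, huniq, rfl⟩ := h
    refine Set.union_subset ih (Set.singleton_subset_iff.2 ?_)
    by_contra hα
    exact hT.2 _ ⟨β, ih hβ, α, ⟨hα, hadj⟩,
      fun α' h' => huniq α' ⟨fun h => h'.1 (ih h), h'.2⟩, rfl⟩

/-- All maximal chains that begin at `S` end, and they end at the same set. -/
theorem existsUnique_isMaximalExtension [Finite V] (G : SimpleGraph V) (S : Set V) :
    ∃! T, IsMaximalExtension G S T := by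
  obtain ⟨T, hT⟩ := Set.Finite.exists_maximal
    (Set.toFinite {X : Set V | Relation.ReflTransGen (IsExtension G) S X})
    ⟨S, Relation.ReflTransGen.refl⟩
  have hmax : IsMaximalExtension G S T := by
    refine ⟨hT.prop, fun T' h => ?_⟩
    have hle := hT.le_of_ge (Relation.ReflTransGen.tail hT.prop h)
    obtain ⟨_, _, α, ⟨hα, _⟩, _, rfl⟩ := h
    exact hα (hle Set.subset_union_left (Or.inr rfl))
  exact ⟨T, hmax, fun T' hT' =>
    Set.Subset.antisymm (hmax.subset_of_chain hT'.1) (hT'.subset_of_chain hmax.1)⟩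

/-- The maximal extension `[S]` of a set `S` of vertices of a finite graph: the common end of all
maximal chains of prolongations that begin at `S`. -/
noncomputable def maximalExtension [Finite V] (G : SimpleGraph V) (S : Set V) : Set V :=
  (existsUnique_isMaximalExtension G S).choose

end Extension

/-! ### Multichannel systems -/

/-- A finite set of particles with channels (indexed by `Γ`) attached to it. The particles form
the type `A`, the real symmetric positive matrix `L` describes their interaction, and
`channel ν k` is the point `ν(k)` of the channel `ν`. Different channels may start at the same
point `ν(0)`. -/
structure MultichannelSystem (A Γ : Type*) where
  /-- the interaction matrix -/
  L : Matrix A A ℝ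
  /-- `L` is symmetric and positive (as a quadratic form on finitely supported vectors) -/
  posSemidef : L.PosSemidef
  /-- the points of the channels -/
  channel : Γ → ℕ → A
  /-- the points `ν(k)`, `k ≥ 1`, are pairwise distinct and different from all `σ(0)` -/
  channel_inj : ∀ ν σ j k, 1 ≤ j → channel ν j = channel σ k → ν = σ ∧ j = k
  /-- consecutive points of a channel interact -/
  channel_interact : ∀ ν k, L (channel ν k) (channel ν (k + 1)) ≠ 0
  /-- the point `ν(k)`, `k ≥ 1`, interacts with nothing but `ν(k - 1)`, itself and `ν(k + 1)` -/
  channel_no_other : ∀ ν k α, L (channel ν (k + 1)) α ≠ 0 →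
    α = channel ν k ∨ α = channel ν (k + 1) ∨ α = channel ν (k + 2)
  /-- from some index on, the coefficients are those of the free operator:
  `a_ν(k) = L(ν(k), ν(k)) = 2` and `b_ν(k) = - L(ν(k), ν(k + 1)) = 1` -/
  stabilized : ∃ K₀ : ℕ, 0 < K₀ ∧ ∀ ν k, K₀ ≤ k →
    L (channel ν k) (channel ν k) = 2 ∧ - L (channel ν k) (channel ν (k + 1)) = 1
  /-- the inner part, i.e. everything but the points `ν(k)`, `k ≥ 1`, is finite -/
  finite_compl : {α : A | ∃ ν k, 1 ≤ k ∧ α = channel ν k}ᶜ.Finite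

namespace MultichannelSystem

variable {A Γ : Type*} (S : MultichannelSystem A Γ)

/-- `𝒜₀`: the points `ν(k)`, `k ≥ 1`, of all channels. -/
def outer : Set A := {α | ∃ ν k, 1 ≤ k ∧ α = S.channel ν k}

/-- `𝒜₁ = 𝒜 ∖ 𝒜₀`: the inner part. -/
def inner : Set A := S.outerᶜ

/-- `ℱ = 𝒜₁ ∪ {ν(1)}`, with `ν` ranging over all channels. -/
def core : Set A := S.inner ∪ {α | ∃ ν, α = S.channel ν 1}

instance [Finite Γ] : Finite S.core := by
  refine (Set.Finite.union S.finite_compl ?_).to_subtype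
  exact (Set.finite_range fun ν => S.channel ν 1).subset (by rintro _ ⟨ν, rfl⟩; exact ⟨ν, rfl⟩)

/-- The graph of the system: two different particles are joined if they interact. -/
def graph : SimpleGraph A where
  Adj α β := α ≠ β ∧ S.L α β ≠ 0
  symm := ⟨fun α β h => ⟨h.1.symm, fun h0 => h.2 (by simpa [h0] using (S.posSemidef.1.apply α β).symm)⟩⟩
  loopless := ⟨fun _ h => h.1 rfl⟩

/-- The points `ν(0)` and `ν(1)` of all channels `ν ≠ ν₀`, as a subset of `ℱ`. -/
def channelStarts (ν₀ : Γ) : Set S.core :=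
  {α | ∃ ν, ν ≠ ν₀ ∧ ((α : A) = S.channel ν 0 ∨ (α : A) = S.channel ν 1)}

/-- `u ∈ C¹([0,1], ℓ²(𝒜))` solves `∂ₜ u(t,α) = i ∑_β L(α,β) u(t,β)`, `t ∈ [0,1]`, `α ∈ 𝒜`
(with one-sided derivatives at `t = 0, 1`; every row of `L` has only finitely many non-zero
entries when there are finitely many channels). -/
def IsSolution (u : ℝ → lp (fun _ : A => ℂ) 2) : Prop :=
  ContDiffOn ℝ 1 u (Set.Icc 0 1) ∧
    ∀ t ∈ Set.Icc (0 : ℝ) 1, ∀ α : A,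
      HasDerivWithinAt (fun s => u s α) (Complex.I * ∑' β, (S.L α β : ℂ) * u t β)
        (Set.Icc 0 1) t

end MultichannelSystem

/-!
The matrix `L` acts as a bounded operator `T` on `ℓ^∞(A)`: all rows are finite and all but finitely
many have absolute sum `4`. A solution is `u(t) = exp (i t T) u(0)`.

*One channel.* Let `c` be a channel along which the interaction is the free one, and write
`λ(z) = 2 - z - z⁻¹`, so that `z ^ k` is a formal eigenvector of the free operator. For a bounded `w`
that decays superexponentially along `c` put
`f_w(z) = ∑_{j ≥ 0} w(c(j+1)) z ^ (j+1) - z (R w)(c 0) + (R w)(c 1)`, where `R = (λ(z) - T)⁻¹` and `|z|`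
is large. This is the pairing of `w` with the generalized eigenvector that grows like `z ^ k` on `c` and
is bounded elsewhere; hence `f_{T w} = λ f_w` (`IsFreeChannel.channelTransform_apply`). Conjugation
of `T` by the weight `r ^ k` on `c` shows that the superexponential decay survives `exp (i T)`, and
`f_{u(1)}(z) = exp (i λ(z)) f_{u(0)}(z)` (`IsFreeChannel.channelTransform_exp`). The decay assumption
makes both transforms `O(exp (a |z|))` with `a < 1/2`, while `|exp (i λ(z))|` is comparable to
`exp (Im z)`; so `f_{u(0)}(z) exp (-i z / 2)` is `O(exp (a |z| - |Im z| / 2))`. By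
Phragmén–Lindelöf in sectors that exhaust a half-plane, such a function vanishes
(`eq_zero_of_exponential_decay_at_infinity`). Then the entire series
`∑ w(c(j+1)) z ^ j` equals a combination of values of the resolvent and tends to `0` at infinity, so
all its coefficients vanish. Since `T u(0)` and `T u(1)` now vanish far out on the channel, the same
argument applies to them, and inductively all `T ^ n u(0)` vanish on `c`
(`IsFreeChannel.pow_apply_eq_zero_of_decay`).

*The whole system.* If all `T ^ n u(0)` vanish at `β` and at all neighbours of `β` but one, then they
vanish at the remaining neighbour (`eq_zero_of_pow_apply_eq_zero`). This carries the zeros down the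
channels `ν ≠ ν₀` to `ν(0)`, through the core along the extensions, and up the channel `ν₀`.
-/

section Auxiliary

open Filter Topology

/-! ### Uniqueness for functions of exponential type -/

/-- Angles close to `π / 2` make `b sin θ` beat `a` plus any multiple of `cos θ`. -/
theorem exists_angle {a b : ℝ} (hab : a < b) (M : ℝ) :
    ∃ θ : ℝ, 0 < θ ∧ θ < Real.pi / 2 ∧ a + M * Real.cos θ ≤ b * Real.sin θ := by
  have hcont : ContinuousAt (fun θ : ℝ => b * Real.sin θ - (a + M * Real.cos θ)) (Real.pi / 2) := by
    fun_prop
  have hpos : 0 < b * Real.sin (Real.pi / 2) - (a + M * Real.cos (Real.pi / 2)) := by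
    simp; linarith
  have h1 : ∀ᶠ θ in 𝓝[<] (Real.pi / 2), 0 < b * Real.sin θ - (a + M * Real.cos θ) :=
    nhdsWithin_le_nhds (hcont.eventually_const_lt hpos)
  have h2 : ∀ᶠ θ in 𝓝[<] (Real.pi / 2), 0 < θ :=
    nhdsWithin_le_nhds (eventually_gt_nhds (by positivity))
  obtain ⟨θ, hθ, hθ0, hθ1⟩ := (h1.and (h2.and self_mem_nhdsWithin)).exists
  exact ⟨θ, hθ0, hθ1, by linarith⟩

section HalfPlane

open Complex

/-- A variant of Carlson's theorem: a function on the right half-plane that is bounded by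
`C exp (a |z| - b |Im z|)`, `a < b`, vanishes on the positive real axis. On the rays `arg z = ± θ` the
bound is at most `C exp (-M Re z)`, where `M → ∞` as `θ → π / 2`, and by Phragmén–Lindelöf it
propagates into the sector between the rays with the same constant `C`. -/
theorem eq_zero_on_right_half_plane_of_exponential_decay {f : ℂ → ℂ} {a b C : ℝ} (hab : a < b)
    (ha : 0 ≤ a) (hf : DifferentiableOn ℂ f {z | 0 < z.re})
    (hbd : ∀ z : ℂ, 0 < z.re → ‖f z‖ ≤ C * Real.exp (a * ‖z‖ - b * |z.im|))
    {x : ℝ} (hx : 0 < x) : f x = 0 := by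
  have hC : 0 ≤ C := by
    have := (norm_nonneg _).trans (hbd 1 (by simp))
    exact nonneg_of_mul_nonneg_left this (Real.exp_pos _)
  have key : ∀ M : ℝ, 0 ≤ M → ‖f x‖ ≤ C * Real.exp (-(M * x)) := by
    intro M hM
    obtain ⟨θ, hθ0, hθ1, hθ⟩ := exists_angle hab M
    have hexpre : ∀ ζ : ℂ, |ζ.im| ≤ θ → 0 < (exp ζ).re := by
      intro ζ hζ
      rw [exp_re]
      have := abs_le.1 hζ
      exact mul_pos (Real.exp_pos _) (Real.cos_pos_of_mem_Ioo ⟨by linarith, by linarith⟩)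
    -- In the coordinate `z = exp ζ` the sector `|arg z| ≤ θ` is the horizontal strip `|Im ζ| ≤ θ`.
    set F : ℂ → ℂ := fun ζ => f (exp ζ) * exp (M * exp ζ) with hF
    have hFn : ∀ ζ : ℂ, |ζ.im| ≤ θ → ‖F ζ‖ ≤ C * Real.exp (a * Real.exp ζ.re
        - b * (Real.exp ζ.re * |Real.sin ζ.im|) + M * (Real.exp ζ.re * Real.cos ζ.im)) := by
      intro ζ hζ
      rw [hF]
      simp only [norm_mul]
      rw [Real.exp_add, ← mul_assoc]
      have h1 := hbd _ (hexpre ζ hζ)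
      rw [norm_exp ζ, exp_im, abs_mul, abs_of_pos (Real.exp_pos _)] at h1
      refine mul_le_mul h1 (le_of_eq ?_) (norm_nonneg _) (by positivity)
      rw [norm_exp]; simp [exp_re]
    have hedge : ∀ ζ : ℂ, |ζ.im| = θ → ‖F ζ‖ ≤ C := by
      intro ζ hζ
      refine (hFn ζ hζ.le).trans ?_
      have hs : |Real.sin ζ.im| = Real.sin θ := by
        rcases abs_choice ζ.im with h | h <;> rw [h] at hζ
        · rw [hζ, abs_of_nonneg (Real.sin_nonneg_of_nonneg_of_le_pi hθ0.le (by linarith))]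
        · rw [← abs_neg, ← Real.sin_neg, hζ,
            abs_of_nonneg (Real.sin_nonneg_of_nonneg_of_le_pi hθ0.le (by linarith))]
      have hc : Real.cos ζ.im = Real.cos θ := by rw [← hζ, Real.cos_abs]
      rw [hs, hc]
      refine mul_le_of_le_one_right hC (Real.exp_le_one_iff.2 ?_)
      have : Real.exp ζ.re * (a + M * Real.cos θ - b * Real.sin θ) ≤ 0 :=
        mul_nonpos_of_nonneg_of_nonpos (Real.exp_pos _).le (by linarith)
      linarith
    have hdiff : ∀ ζ : ℂ, |ζ.im| ≤ θ → DifferentiableAt ℂ F ζ := by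
      intro ζ hζ
      have h1 : DifferentiableAt ℂ f (exp ζ) :=
        hf.differentiableAt ((isOpen_lt continuous_const continuous_re).mem_nhds (hexpre ζ hζ))
      have h2 : DifferentiableAt ℂ (fun ζ => f (exp ζ)) ζ :=
        DifferentiableAt.comp ζ h1 differentiableAt_exp
      exact h2.mul (by fun_prop)
    have hclos : closure (im ⁻¹' Set.Ioo (-θ) θ) ⊆ {ζ : ℂ | |ζ.im| ≤ θ} :=
      closure_minimal (fun ζ hζ => abs_le.2 ⟨hζ.1.le, hζ.2.le⟩)
        (isClosed_le (by fun_prop) continuous_const)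
    have hPL := PhragmenLindelof.horizontal_strip (f := F) (a := -θ) (b := θ) (C := C)
      (z := (Real.log x : ℂ))
      (DifferentiableOn.diffContOnCl fun ζ hζ => (hdiff ζ (hclos hζ)).differentiableWithinAt)
      ⟨1, by rw [lt_div_iff₀ (by linarith)]; linarith, a + M, by
        refine Asymptotics.IsBigO.of_bound C ?_
        filter_upwards [mem_inf_of_right (mem_principal_self _)] with ζ hζ
        have hζ' : |ζ.im| ≤ θ := abs_le.2 ⟨hζ.1.le, hζ.2.le⟩
        refine (hFn ζ hζ').trans ?_
        rw [Real.norm_eq_abs, abs_of_pos (Real.exp_pos _)]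
        refine mul_le_mul_of_nonneg_left (Real.exp_le_exp.2 ?_) hC
        have e1 : Real.exp ζ.re ≤ Real.exp (1 * |ζ.re|) :=
          Real.exp_le_exp.2 (by simpa using le_abs_self _)
        have e2 : 0 ≤ b * (Real.exp ζ.re * |Real.sin ζ.im|) := by
          have : 0 ≤ b := by linarith
          positivity
        have e3 : Real.exp ζ.re * Real.cos ζ.im ≤ Real.exp ζ.re :=
          mul_le_of_le_one_right (Real.exp_pos _).le (Real.cos_le_one _)
        have e4 := mul_le_mul_of_nonneg_left (e3.trans e1) hM
        have e5 := mul_le_mul_of_nonneg_left e1 ha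
        linarith⟩
      (fun z hz => hedge z (by rw [hz, abs_neg, abs_of_pos hθ0]))
      (fun z hz => hedge z (by rw [hz, abs_of_pos hθ0]))
      (by simp [hθ0.le]) (by simp [hθ0.le])
    have hex : exp (Real.log x : ℂ) = (x : ℂ) := by
      rw [← ofReal_exp, Real.exp_log hx]
    simp only [hF, hex, norm_mul] at hPL
    rw [← ofReal_mul, norm_exp, ofReal_re] at hPL
    rwa [Real.exp_neg, ← div_eq_mul_inv, le_div_iff₀ (Real.exp_pos _)]
  have hlim : Tendsto (fun M : ℝ => C * Real.exp (-(M * x))) atTop (𝓝 (C * 0)) :=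
    (Real.tendsto_exp_neg_atTop_nhds_zero.comp (tendsto_id.atTop_mul_const hx)).const_mul C
  have := ge_of_tendsto hlim ((eventually_ge_atTop 0).mono fun M hM => key M hM)
  simpa using this

/-- The exterior-domain version: the bound `C exp (a |z| - b |Im z|)`, `a < b`, outside of a disc
forces the function to vanish there. -/
theorem eq_zero_of_exponential_decay_at_infinity {f : ℂ → ℂ} {a b C R : ℝ} (hab : a < b)
    (ha : 0 ≤ a) (hR : 0 < R) (hf : ∀ z : ℂ, R ≤ ‖z‖ → DifferentiableAt ℂ f z)
    (hbd : ∀ z : ℂ, R ≤ ‖z‖ → ‖f z‖ ≤ C * Real.exp (a * ‖z‖ - b * |z.im|))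
    {z : ℂ} (hz : R < ‖z‖) : f z = 0 := by
  have hR' : ∀ w : ℂ, 0 < w.re → R < ‖w + R‖ := fun w hw => by
    refine lt_of_lt_of_le ?_ (re_le_norm _)
    simpa using hw
  have hC : 0 ≤ C := by
    have := (norm_nonneg _).trans (hbd z hz.le)
    exact nonneg_of_mul_nonneg_left this (Real.exp_pos _)
  have hreal : ∀ x : ℝ, R < x → f x = 0 := by
    intro x hx
    have := eq_zero_on_right_half_plane_of_exponential_decay (f := fun w => f (w + R))
      (C := C * Real.exp (a * R)) hab ha
      (fun w hw => ((hf _ (hR' w hw).le).comp w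
        (by fun_prop : DifferentiableAt ℂ (fun w : ℂ => w + R) w)).differentiableWithinAt)
      (fun w hw => by
        refine (hbd _ (hR' w hw).le).trans ?_
        rw [mul_assoc, ← Real.exp_add]
        refine mul_le_mul_of_nonneg_left (Real.exp_le_exp.2 ?_) hC
        have h1 : ‖w + R‖ ≤ ‖w‖ + R := (norm_add_le _ _).trans (by simp [abs_of_pos hR])
        have h2 := mul_le_mul_of_nonneg_left h1 ha
        simp
        linarith) (sub_pos.2 hx)
    simpa using this
  -- The exponential map carries the half-plane `log R < re ζ` onto the exterior of the disc.
  set U : Set ℂ := {ζ | Real.log R < ζ.re}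
  have hU : IsOpen U := isOpen_lt continuous_const continuous_re
  have hUn : ∀ ζ ∈ U, R < ‖exp ζ‖ := fun ζ hζ => by
    rw [norm_exp]; exact (Real.log_lt_iff_lt_exp hR).1 hζ
  have han : AnalyticOnNhd ℂ (fun ζ => f (exp ζ)) U := by
    refine DifferentiableOn.analyticOnNhd (fun ζ hζ => ?_) hU
    exact (DifferentiableAt.comp ζ (hf _ (hUn ζ hζ).le) differentiableAt_exp).differentiableWithinAt
  have hpre : IsPreconnected U := (convex_halfSpace_re_gt _).isPreconnected
  set p : ℝ := Real.log R + 1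
  have hp : (p : ℂ) ∈ U := by simp [U, p]
  have hfreq : ∃ᶠ ζ in 𝓝[≠] (p : ℂ), f (exp ζ) = 0 := by
    have hmap : Tendsto (fun x : ℝ => (x : ℂ)) (𝓝[≠] p) (𝓝[≠] (p : ℂ)) :=
      tendsto_nhdsWithin_of_tendsto_nhds_of_eventually_within _
        (continuous_ofReal.continuousAt.tendsto.mono_left nhdsWithin_le_nhds)
        (eventually_mem_nhdsWithin.mono fun x hx => by simpa using hx)
    refine hmap.frequently (Eventually.frequently ?_)
    have : ∀ᶠ x in 𝓝 p, Real.log R < x := eventually_gt_nhds (by simp [p])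
    filter_upwards [nhdsWithin_le_nhds this] with x hx
    rw [← ofReal_exp]
    exact hreal _ ((Real.log_lt_iff_lt_exp hR).1 hx)
  have hall := han.eqOn_zero_of_preconnected_of_frequently_eq_zero hpre hp hfreq
  have hz0 : z ≠ 0 := norm_pos_iff.1 (hR.trans hz)
  have := hall (show log z ∈ U by
    simp only [U, Set.mem_ofPred_eq, log_re]; exact Real.log_lt_log hR hz)
  simpa [exp_log hz0] using this

end HalfPlane

/-! ### Entire functions given by power series -/

theorem hasFPowerSeriesOnBall_tsum_pow {w : ℕ → ℂ}
    (hs : ∀ r : ℝ, Summable fun n => ‖w n‖ * r ^ n) :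
    HasFPowerSeriesOnBall (fun z : ℂ => ∑' n, w n * z ^ n)
      (FormalMultilinearSeries.ofScalars ℂ w) 0 ⊤ := by
  set p := FormalMultilinearSeries.ofScalars ℂ w
  have hrad : p.radius = ⊤ := p.radius_eq_top_of_summable_norm fun r => by
    simpa [p, FormalMultilinearSeries.ofScalars_norm] using hs r
  have hsum : p.sum = fun z : ℂ => ∑' n, w n * z ^ n := funext fun z => by
    have := FormalMultilinearSeries.ofScalars_sum_eq (E := ℂ) w z
    simpa [p, FormalMultilinearSeries.ofScalarsSum, smul_eq_mul] using this
  have hball := p.hasFPowerSeriesOnBall (by rw [hrad]; exact ENNReal.zero_lt_top)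
  rwa [hrad, hsum] at hball

theorem differentiable_tsum_pow {w : ℕ → ℂ} (hs : ∀ r : ℝ, Summable fun n => ‖w n‖ * r ^ n) :
    Differentiable ℂ fun z : ℂ => ∑' n, w n * z ^ n := fun z =>
  ((hasFPowerSeriesOnBall_tsum_pow hs).differentiableOn z (by simp)).differentiableAt (by simp)

/-- An everywhere convergent power series that tends to zero at infinity has no nonzero
coefficients, by Liouville's theorem. -/
theorem coeff_eq_zero_of_tendsto_zero {w : ℕ → ℂ} (hs : ∀ r : ℝ, Summable fun n => ‖w n‖ * r ^ n)
    (hlim : Tendsto (fun z : ℂ => ∑' n, w n * z ^ n) (Bornology.cobounded ℂ) (𝓝 0)) : w = 0 := by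
  have hzero : (fun z : ℂ => ∑' n, w n * z ^ n) = 0 := funext fun z =>
    (differentiable_tsum_pow hs).apply_eq_of_tendsto_cocompact z
      (by rwa [← Metric.cobounded_eq_cocompact])
  have h := (hasFPowerSeriesOnBall_tsum_pow hs).hasFPowerSeriesAt
  rw [hzero] at h
  exact (FormalMultilinearSeries.ofScalars_series_eq_zero (E := ℂ)).1 h.eq_zero

/-! ### Bounded operators on `ℓ^∞` and their exponentials -/

variable {A : Type*}

local notation "ℓ∞(" A ")" => lp (fun _ : A => ℂ) ∞

theorem norm_lp_top_apply_le (x : ℓ∞(A)) (α : A) : ‖x α‖ ≤ ‖x‖ :=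
  lp.norm_apply_le_norm (by simp) x α

theorem exists_lp_top_eq {f : A → ℂ} {C : ℝ} (hf : ∀ α, ‖f α‖ ≤ C) :
    ∃ x : ℓ∞(A), ∀ α, x α = f α :=
  ⟨⟨f, memℓp_infty ⟨C, by rintro _ ⟨α, rfl⟩; exact hf α⟩⟩, fun _ => rfl⟩

/-- A kernel with uniformly bounded absolute row sums acts boundedly on `ℓ^∞`. -/
theorem exists_clm_of_kernel {M : A → A → ℂ} {C : ℝ} (hC : 0 ≤ C)
    (hs : ∀ α, Summable fun β => ‖M α β‖) (hM : ∀ α, ∑' β, ‖M α β‖ ≤ C) :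
    ∃ T : ℓ∞(A) →L[ℂ] ℓ∞(A), ∀ x α, T x α = ∑' β, M α β * x β := by
  have hle : ∀ (x : ℓ∞(A)) α β, ‖M α β * x β‖ ≤ ‖M α β‖ * ‖x‖ := fun x α β => by
    rw [norm_mul]
    exact mul_le_mul_of_nonneg_left (norm_lp_top_apply_le x β) (norm_nonneg _)
  have hsum : ∀ (x : ℓ∞(A)) α, Summable fun β => M α β * x β := fun x α =>
    Summable.of_norm_bounded ((hs α).mul_right ‖x‖) (hle x α)
  have hb : ∀ (x : ℓ∞(A)) α, ‖∑' β, M α β * x β‖ ≤ C * ‖x‖ := fun x α =>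
    (tsum_of_norm_bounded ((hs α).hasSum.mul_right ‖x‖) (hle x α)).trans
      (mul_le_mul_of_nonneg_right (hM α) (norm_nonneg _))
  refine ⟨LinearMap.mkContinuous
    { toFun := fun x => ⟨fun α => ∑' β, M α β * x β,
        memℓp_infty ⟨C * ‖x‖, by rintro _ ⟨α, rfl⟩; exact hb x α⟩⟩
      map_add' := fun x y => by
        ext α
        simp only [lp.coeFn_add, Pi.add_apply, mul_add]
        exact (hsum x α).tsum_add (hsum y α)
      map_smul' := fun c x => by
        ext α
        simp only [lp.coeFn_smul, Pi.smul_apply, smul_eq_mul, RingHom.id_apply]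
        rw [← tsum_mul_left]
        exact tsum_congr fun β => by ring } C fun x =>
    lp.norm_le_of_forall_le (by positivity) fun α => hb x α, fun x α => rfl⟩

theorem exists_clm_of_diagonal {d : A → ℂ} {C : ℝ} (hd : ∀ α, ‖d α‖ ≤ C) :
    ∃ D : ℓ∞(A) →L[ℂ] ℓ∞(A), ∀ x α, D x α = d α * x α :=
  ⟨ContinuousLinearMap.mul ℂ ℓ∞(A) ⟨d, memℓp_infty ⟨C, by rintro _ ⟨α, rfl⟩; exact hd α⟩⟩,
    fun _ _ => rfl⟩

/-- An operator that intertwines `S` and `T` intertwines their exponentials. -/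
theorem ContinuousLinearMap.comp_exp_of_comp_eq {E F : Type*} [NormedAddCommGroup E]
    [NormedSpace ℂ E] [CompleteSpace E] [NormedAddCommGroup F] [NormedSpace ℂ F] [CompleteSpace F]
    {φ : E →L[ℂ] F} {S : E →L[ℂ] E} {T : F →L[ℂ] F} (h : ∀ x, φ (S x) = T (φ x)) (x : E) :
    φ (NormedSpace.exp S x) = NormedSpace.exp T (φ x) := by
  have hpow : ∀ n : ℕ, φ ((S ^ n) x) = (T ^ n) (φ x) := by
    intro n
    induction n with
    | zero => simp
    | succ n ih =>
      rw [pow_succ', pow_succ']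
      change φ (S ((S ^ n) x)) = T ((T ^ n) (φ x))
      rw [h, ih]
  have h1 := (NormedSpace.exp_series_hasSum_exp' (𝕂 := ℂ) S).mapL
    (φ.comp (ContinuousLinearMap.apply ℂ E x))
  have h2 := (NormedSpace.exp_series_hasSum_exp' (𝕂 := ℂ) T).mapL
    (ContinuousLinearMap.apply ℂ F (φ x))
  simp only [comp_apply, apply_apply, map_smul, hpow] at h1 h2
  exact h1.unique h2

theorem ContinuousLinearMap.apply_exp_of_eigenfunctional {E : Type*} [NormedAddCommGroup E]
    [NormedSpace ℂ E] [CompleteSpace E] {φ : E →L[ℂ] ℂ} {S : E →L[ℂ] E} {μ : ℂ}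
    (h : ∀ x, φ (S x) = μ * φ x) (x : E) :
    φ (NormedSpace.exp S x) = Complex.exp μ * φ x := by
  have h1 := comp_exp_of_comp_eq (φ := φ) (S := S) (T := algebraMap ℂ (ℂ →L[ℂ] ℂ) μ)
    (fun x => by simp [h, Algebra.algebraMap_eq_smul_one]) x
  rw [h1, ← NormedSpace.algebraMap_exp_comm, ← Complex.exp_eq_exp_ℂ]
  simp [Algebra.algebraMap_eq_smul_one]

/-- The solutions of `W' = S W` on `[0, 1]` are `W(t) = exp (t S) W(0)`. -/
theorem eq_exp_of_hasDerivWithinAt {E : Type*} [NormedAddCommGroup E] [NormedSpace ℂ E]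
    [CompleteSpace E] {S : E →L[ℂ] E} {W : ℝ → E}
    (hW : ∀ t ∈ Set.Icc (0 : ℝ) 1, HasDerivWithinAt W (S (W t)) (Set.Icc 0 1) t)
    {t : ℝ} (ht : t ∈ Set.Icc (0 : ℝ) 1) : W t = NormedSpace.exp ((t : ℂ) • S) (W 0) := by
  have hV : ∀ t : ℝ, HasDerivAt (fun t : ℝ => NormedSpace.exp ((t : ℂ) • S) (W 0))
      (S (NormedSpace.exp ((t : ℂ) • S) (W 0))) t := fun t => by
    have h := (hasDerivAt_exp_smul_const' (𝕂 := ℂ) S (t : ℂ)).scomp t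
      Complex.ofRealCLM.hasDerivAt
    have := (ContinuousLinearMap.apply ℂ E (W 0)).restrictScalars ℝ |>.hasFDerivAt.comp_hasDerivAt t h
    simpa [Function.comp_def] using this
  have hlip : ∀ t ∈ Set.Ico (0 : ℝ) 1, LipschitzOnWith ‖S‖₊ (fun x => S x) Set.univ :=
    fun t _ => S.lipschitz.lipschitzOnWith
  have := ODE_solution_unique_of_mem_Icc_right (v := fun _ x => S x) (s := fun _ => Set.univ)
    (K := ‖S‖₊) (f := W) (g := fun t : ℝ => NormedSpace.exp ((t : ℂ) • S) (W 0))
    (a := 0) (b := 1) hlip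
    (fun t ht => (hW t ht).continuousWithinAt)
    (fun t ht => ((hW t ⟨ht.1, ht.2.le⟩).mono_of_mem_nhdsWithin
      (mem_of_superset (Icc_mem_nhdsGE ht.2) (Set.Icc_subset_Icc_left ht.1))))
    (fun t ht => trivial)
    (fun t ht => (hV t).continuousAt.continuousWithinAt)
    (fun t ht => (hV t).hasDerivWithinAt) (fun t ht => trivial) (by simp)
  exact this ht

/-! ### The generalized eigenvector transform along a free channel -/

/-- The points `c 0, c 1, …` form a channel on which the kernel `M` is that of the free operator: for
`k ≥ 1` the row of `c k` has the entry `2` at `c k`, the entry `-1` at `c (k - 1)` and `c (k + 1)`, and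
no others. Nothing is required of the row of `c 0`, through which the channel is attached. -/
structure IsFreeChannel (M : A → A → ℂ) (c : ℕ → A) : Prop where
  injective : Function.Injective c
  band : ∀ k β, M (c (k + 1)) β ≠ 0 → β = c k ∨ β = c (k + 1) ∨ β = c (k + 2)
  diag : ∀ k, M (c (k + 1)) (c (k + 1)) = 2
  prev : ∀ k, M (c (k + 1)) (c k) = -1
  next : ∀ k, M (c (k + 1)) (c (k + 2)) = -1

namespace IsFreeChannel

variable {M : A → A → ℂ} {c : ℕ → A} {T : ℓ∞(A) →L[ℂ] ℓ∞(A)}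

theorem apply_succ (hc : IsFreeChannel M c) (hT : ∀ x α, T x α = ∑' β, M α β * x β)
    (x : ℓ∞(A)) (k : ℕ) :
    T x (c (k + 1)) = 2 * x (c (k + 1)) - x (c k) - x (c (k + 2)) := by
  classical
  have h1 : c k ≠ c (k + 1) := hc.injective.ne (by omega)
  have h2 : c k ≠ c (k + 2) := hc.injective.ne (by omega)
  have h3 : c (k + 1) ≠ c (k + 2) := hc.injective.ne (by omega)
  rw [hT, tsum_eq_sum (s := {c k, c (k + 1), c (k + 2)})]
  · rw [Finset.sum_insert (by simp [h1, h2]), Finset.sum_pair h3, hc.diag, hc.prev, hc.next]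
    ring
  · intro β hβ
    by_contra h
    have := hc.band k β (left_ne_zero_of_mul h)
    simp at hβ
    tauto

/-- The weight `r ^ k` at `c k`, and `1` off the channel, changes at most by the factor `r` between
interacting points. -/
theorem exists_weight (hc : IsFreeChannel M c) {r : ℝ} (hr : 1 ≤ r) :
    ∃ d : A → ℝ, (∀ k, d (c k) = r ^ k) ∧ (∀ α, α ∉ Set.range c → d α = 1) ∧ (∀ α, 1 ≤ d α) ∧
      ∀ α β, M α β ≠ 0 → d α ≤ r * d β := by
  have hd : ∀ k, Function.extend c (fun k => r ^ k) 1 (c k) = r ^ k :=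
    fun k => hc.injective.extend_apply _ _ _
  have hd' : ∀ α, α ∉ Set.range c → Function.extend c (fun k => r ^ k) 1 α = 1 := fun α hα => by
    rw [Function.extend_apply' _ _ _ (by simpa using hα)]; rfl
  have h1 : ∀ α, 1 ≤ Function.extend c (fun k => r ^ k) 1 α := fun α => by
    by_cases hα : α ∈ Set.range c
    · obtain ⟨k, rfl⟩ := hα
      rw [hd]
      exact one_le_pow₀ hr
    · rw [hd' α hα]
  refine ⟨_, hd, hd', h1, fun α β hM => ?_⟩
  have htriv : 1 ≤ r * Function.extend c (fun k => r ^ k) 1 β := by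
    nlinarith [h1 β]
  by_cases hα : α ∈ Set.range c
  · obtain ⟨k, rfl⟩ := hα
    cases k with
    | zero => rwa [hd, pow_zero]
    | succ k =>
      have hmono : ∀ j, k ≤ j → r ^ (k + 1) ≤ r * r ^ j := fun j hj => by
        rw [← pow_succ']
        exact pow_le_pow_right₀ hr (by omega)
      rcases hc.band k β hM with rfl | rfl | rfl <;> simp only [hd] <;> exact hmono _ (by omega)
  · rwa [hd' α hα]

/-- The operator `T` is bounded on the space of all `w` for which `w(c k) = O(r⁻ᵏ)`. This space is
parametrized as the range of the diagonal operator `D`, and `T'` is `T` in this parametrization. -/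
theorem exists_weighted_operator (hc : IsFreeChannel M c) {C : ℝ}
    (hs : ∀ α, Summable fun β => ‖M α β‖) (hM : ∀ α, ∑' β, ‖M α β‖ ≤ C)
    (hT : ∀ x α, T x α = ∑' β, M α β * x β) {r : ℝ} (hr : 1 ≤ r) :
    ∃ T' D : ℓ∞(A) →L[ℂ] ℓ∞(A), (∀ x, D (T' x) = T (D x)) ∧
      (∀ x k, D x (c k) = (r : ℂ)⁻¹ ^ k * x (c k)) ∧
      ∀ w : ℓ∞(A), (∃ B, ∀ k, ‖w (c k)‖ * r ^ k ≤ B) → ∃ x, D x = w := by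
  obtain ⟨d, hdc, hd1, hd, hdM⟩ := hc.exists_weight hr
  have hdpos : ∀ α, 0 < d α := fun α => one_pos.trans_le (hd α)
  have hne : ∀ α, (d α : ℂ) ≠ 0 := fun α => Complex.ofReal_ne_zero.2 (hdpos α).ne'
  have hbound : ∀ α β, ‖(d α : ℂ) * M α β * (d β : ℂ)⁻¹‖ ≤ r * ‖M α β‖ := fun α β => by
    by_cases h : M α β = 0
    · simp [h]
    · rw [norm_mul, norm_mul, norm_inv, Complex.norm_of_nonneg (hdpos α).le,
        Complex.norm_of_nonneg (hdpos β).le, ← div_eq_mul_inv, div_le_iff₀ (hdpos β)]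
      nlinarith [hdM α β h, norm_nonneg (M α β)]
  have hs' : ∀ α, Summable fun β => ‖(d α : ℂ) * M α β * (d β : ℂ)⁻¹‖ := fun α =>
    Summable.of_nonneg_of_le (fun _ => norm_nonneg _) (hbound α) ((hs α).mul_left r)
  have hle : ∀ α, ∑' β, ‖(d α : ℂ) * M α β * (d β : ℂ)⁻¹‖ ≤ r * |C| := fun α =>
    ((hs' α).tsum_le_tsum (hbound α) ((hs α).mul_left r)).trans <| by
      rw [tsum_mul_left]
      exact mul_le_mul_of_nonneg_left ((hM α).trans (le_abs_self C)) (by linarith)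
  obtain ⟨T', hT'⟩ := exists_clm_of_kernel (by positivity) hs' hle
  obtain ⟨D, hD⟩ := exists_clm_of_diagonal (d := fun α => (d α : ℂ)⁻¹) (C := 1) fun α => by
    rw [norm_inv, Complex.norm_of_nonneg (hdpos α).le]
    exact inv_le_one_of_one_le₀ (hd α)
  refine ⟨T', D, fun x => ?_, fun x k => ?_, fun w ⟨B, hB⟩ => ?_⟩
  · ext α
    rw [hD, hT', hT, ← tsum_mul_left]
    refine tsum_congr fun β => ?_
    rw [hD]
    field_simp [hne α]
  · rw [hD, hdc]
    push_cast
    rw [inv_pow]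
  · obtain ⟨x, hx⟩ := exists_lp_top_eq (f := fun α => (d α : ℂ) * w α) (C := max B ‖w‖)
      fun α => by
        rw [norm_mul, Complex.norm_of_nonneg (hdpos α).le]
        by_cases hα : α ∈ Set.range c
        · obtain ⟨k, rfl⟩ := hα
          rw [hdc, mul_comm]
          exact (hB k).trans (le_max_left _ _)
        · rw [hd1 α hα, one_mul]
          exact (norm_lp_top_apply_le w α).trans (le_max_right _ _)
    refine ⟨x, ?_⟩
    ext α
    rw [hD, hx, inv_mul_cancel_left₀ (hne α)]

end IsFreeChannel

theorem exists_clm_of_summable (c : ℕ → A) {a : ℕ → ℂ} (ha : Summable fun j => ‖a j‖) :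
    ∃ φ : ℓ∞(A) →L[ℂ] ℂ, ∀ x, φ x = ∑' j, a j * x (c j) := by
  have hle : ∀ (x : ℓ∞(A)) j, ‖a j * x (c j)‖ ≤ ‖a j‖ * ‖x‖ := fun x j => by
    rw [norm_mul]
    exact mul_le_mul_of_nonneg_left (norm_lp_top_apply_le x _) (norm_nonneg _)
  have hsum : ∀ x : ℓ∞(A), Summable fun j => a j * x (c j) := fun x =>
    Summable.of_norm_bounded (ha.mul_right ‖x‖) (hle x)
  exact ⟨LinearMap.mkContinuous
    { toFun := fun x => ∑' j, a j * x (c j)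
      map_add' := fun x y => by
        simp only [lp.coeFn_add, Pi.add_apply, mul_add]
        exact (hsum x).tsum_add (hsum y)
      map_smul' := fun s x => by
        simp only [lp.coeFn_smul, Pi.smul_apply, smul_eq_mul, RingHom.id_apply]
        rw [← tsum_mul_left]
        exact tsum_congr fun j => by ring } (∑' j, ‖a j‖) fun x =>
    tsum_of_norm_bounded (ha.hasSum.mul_right ‖x‖) (hle x), fun _ => rfl⟩

/-- The eigenvalue `2 - z - z⁻¹` of the free operator `w ↦ 2 w(k) - w(k - 1) - w(k + 1)` that belongs
to the formal eigenvector `z ^ k`. -/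
noncomputable def freeSymbol (z : ℂ) : ℂ := 2 - z - z⁻¹

/-- The pairing of `w` with the generalized eigenvector of `T` that is `z ^ k` plus a bounded
term on the channel `c`, and bounded elsewhere. The bounded part of the eigenvector is expressed by the
resolvent `(λ - T)⁻¹` at `λ = freeSymbol z`, which acts here on `w`. The definition is meaningful when
`freeSymbol z` is outside of the spectrum of `T` and the series converges. -/
noncomputable def channelTransform (T : ℓ∞(A) →L[ℂ] ℓ∞(A)) (c : ℕ → A) (w : ℓ∞(A)) (z : ℂ) : ℂ :=
  z * ∑' j, w (c (j + 1)) * z ^ j - z * resolvent T (freeSymbol z) w (c 0)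
    + resolvent T (freeSymbol z) w (c 1)

theorem resolvent_apply_apply {T : ℓ∞(A) →L[ℂ] ℓ∞(A)} {μ : ℂ} (hμ : μ ∈ resolventSet ℂ T)
    (w : ℓ∞(A)) : resolvent T μ (T w) = μ • resolvent T μ w - w := by
  have h : resolvent T μ * (algebraMap ℂ (ℓ∞(A) →L[ℂ] ℓ∞(A)) μ - T) = 1 :=
    Ring.inverse_mul_cancel _ hμ
  have h2 := DFunLike.congr_fun h w
  have h3 : resolvent T μ (μ • w - T w) = w := by
    simpa [Algebra.algebraMap_eq_smul_one] using h2
  rw [map_sub, map_smul] at h3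
  rw [eq_sub_iff_add_eq, add_comm]
  exact (sub_eq_iff_eq_add.1 h3).symm

namespace IsFreeChannel

variable {M : A → A → ℂ} {c : ℕ → A} {T : ℓ∞(A) →L[ℂ] ℓ∞(A)}

theorem channelTransform_apply (hc : IsFreeChannel M c)
    (hT : ∀ x α, T x α = ∑' β, M α β * x β) {w : ℓ∞(A)} {z : ℂ} (hz : z ≠ 0)
    (hres : freeSymbol z ∈ resolventSet ℂ T) (hw : Summable fun k => w (c k) * z ^ k) :
    channelTransform T c (T w) z = freeSymbol z * channelTransform T c w z := by
  have s1 : Summable fun k => w (c (k + 1)) * z ^ k := by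
    have := ((summable_nat_add_iff 1).2 hw).mul_right z⁻¹
    refine this.congr fun k => ?_
    field_simp
    ring
  have s2 : Summable fun k => w (c (k + 2)) * z ^ k := by
    have := ((summable_nat_add_iff 1).2 s1).mul_right z⁻¹
    refine this.congr fun k => ?_
    simp only [add_assoc, one_add_one_eq_two]
    field_simp
    ring
  have e1 : ∑' k, w (c k) * z ^ k = w (c 0) + z * ∑' k, w (c (k + 1)) * z ^ k := by
    rw [hw.tsum_eq_zero_add, pow_zero, mul_one, ← tsum_mul_left]
    congr 1
    exact tsum_congr fun k => by ring
  have e2 : ∑' k, w (c (k + 1)) * z ^ k = w (c 1) + z * ∑' k, w (c (k + 2)) * z ^ k := by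
    rw [s1.tsum_eq_zero_add, pow_zero, mul_one, ← tsum_mul_left]
    congr 1
    exact tsum_congr fun k => by ring_nf
  have e3 : ∑' j, T w (c (j + 1)) * z ^ j = 2 * ∑' k, w (c (k + 1)) * z ^ k
      - ∑' k, w (c k) * z ^ k - ∑' k, w (c (k + 2)) * z ^ k := by
    rw [← tsum_mul_left, ← (s1.mul_left 2).tsum_sub hw, ← ((s1.mul_left 2).sub hw).tsum_sub s2]
    refine tsum_congr fun k => ?_
    rw [hc.apply_succ hT]
    ring
  have e2' : ∑' k, w (c (k + 2)) * z ^ k = z⁻¹ * (∑' k, w (c (k + 1)) * z ^ k - w (c 1)) := by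
    rw [e2]; field_simp; ring
  simp only [channelTransform]
  rw [e3, e2', e1, resolvent_apply_apply hres]
  simp only [lp.coeFn_sub, lp.coeFn_smul, Pi.sub_apply, Pi.smul_apply, smul_eq_mul]
  generalize resolvent T (freeSymbol z) w = v
  generalize ∑' k, w (c (k + 1)) * z ^ k = q
  rw [freeSymbol]
  field_simp
  ring

/-- The transform diagonalizes the evolution: it turns `exp (i T)` into multiplication by
`exp (i λ(z))`. On the weighted space of `exists_weighted_operator` with `r > |z|`, the transform is
a bounded functional, so that it can be applied to the exponential series. -/
theorem channelTransform_exp (hc : IsFreeChannel M c) {C : ℝ}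
    (hs : ∀ α, Summable fun β => ‖M α β‖) (hM : ∀ α, ∑' β, ‖M α β‖ ≤ C)
    (hT : ∀ x α, T x α = ∑' β, M α β * x β) {w : ℓ∞(A)}
    (hw : ∀ r : ℝ, Summable fun k => ‖w (c k)‖ * r ^ k) {z : ℂ} (hz : z ≠ 0)
    (hres : freeSymbol z ∈ resolventSet ℂ T) :
    channelTransform T c (NormedSpace.exp (Complex.I • T) w) z
      = Complex.exp (Complex.I * freeSymbol z) * channelTransform T c w z := by
  set r : ℝ := ‖z‖ + 1
  have hzr : ‖z‖ < r := by simp [r]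
  have hr : 1 ≤ r := by simp [r]
  have hr0 : 0 < r := by linarith
  obtain ⟨T', D, hint, hD, hsurj⟩ := hc.exists_weighted_operator hs hM hT hr
  obtain ⟨x, rfl⟩ := hsurj w ⟨∑' k, ‖w (c k)‖ * r ^ k, fun k =>
    (hw r).le_tsum k fun j _ => by positivity⟩
  have hq : ‖z * (r : ℂ)⁻¹‖ < 1 := by
    rw [norm_mul, norm_inv, Complex.norm_of_nonneg hr0.le, ← div_eq_mul_inv, div_lt_one hr0]
    exact hzr
  have hgeo : Summable fun k : ℕ => ‖(z * (r : ℂ)⁻¹) ^ k‖ := by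
    simpa only [norm_pow] using summable_geometric_of_lt_one (norm_nonneg _) hq
  obtain ⟨φ₀, hφ₀⟩ := exists_clm_of_summable (fun j => c (j + 1))
    (a := fun j => (r : ℂ)⁻¹ * (z * (r : ℂ)⁻¹) ^ j)
    (by simpa only [norm_mul] using hgeo.mul_left _)
  set R := resolvent T (freeSymbol z)
  let φ : ℓ∞(A) →L[ℂ] ℂ := z • φ₀ - z • ((lp.evalCLM ℂ (fun _ : A => ℂ) ∞ (c 0)) ∘L R ∘L D)
    + (lp.evalCLM ℂ (fun _ : A => ℂ) ∞ (c 1)) ∘L R ∘L D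
  have hφ : ∀ y, φ y = channelTransform T c (D y) z := by
    intro y
    have h0 : φ₀ y = ∑' j, D y (c (j + 1)) * z ^ j := by
      rw [hφ₀]
      refine tsum_congr fun j => ?_
      rw [hD, mul_pow]
      ring
    change z * φ₀ y - z * R (D y) (c 0) + R (D y) (c 1) = _
    rw [h0]
    rfl
  have heig : ∀ y, φ ((Complex.I • T') y) = Complex.I * freeSymbol z * φ y := by
    intro y
    have hsum : Summable fun k => D y (c k) * z ^ k := by
      refine Summable.of_norm_bounded (hgeo.mul_right ‖y‖) fun k => ?_
      rw [hD, mul_right_comm, ← mul_pow, norm_mul, mul_comm z]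
      exact mul_le_mul_of_nonneg_left (norm_lp_top_apply_le y _) (norm_nonneg _)
    change φ (Complex.I • T' y) = _
    rw [map_smul, hφ, hφ, hint, hc.channelTransform_apply hT hz hres hsum, smul_eq_mul, mul_assoc]
  have hexp : NormedSpace.exp (Complex.I • T) (D x) = D (NormedSpace.exp (Complex.I • T') x) := by
    refine (ContinuousLinearMap.comp_exp_of_comp_eq (fun y => ?_) x).symm
    change D (Complex.I • T' y) = Complex.I • T (D y)
    rw [map_smul, hint]
  rw [hexp, ← hφ, ← hφ, ContinuousLinearMap.apply_exp_of_eigenfunctional heig]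

end IsFreeChannel

/-! ### Sequences with factorial decay -/

theorem summable_mul_pow_of_le_div_factorial {w : ℕ → ℂ} {a B : ℝ}
    (hw : ∀ k, ‖w k‖ ≤ B * (a ^ k / k.factorial)) (r : ℝ) :
    Summable fun k => ‖w k‖ * r ^ k := by
  refine Summable.of_norm_bounded ((Real.summable_pow_div_factorial (a * |r|)).mul_left B)
    fun k => ?_
  rw [norm_mul, norm_norm, norm_pow, Real.norm_eq_abs r]
  calc ‖w k‖ * |r| ^ k ≤ B * (a ^ k / k.factorial) * |r| ^ k :=
        mul_le_mul_of_nonneg_right (hw k) (by positivity)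
    _ = B * ((a * |r|) ^ k / k.factorial) := by rw [mul_pow]; ring

theorem summable_norm_succ_mul_pow {w : ℕ → ℂ} (hw : ∀ r : ℝ, Summable fun k => ‖w k‖ * r ^ k)
    (r : ℝ) : Summable fun k => ‖w (k + 1)‖ * r ^ k := by
  rcases eq_or_ne r 0 with rfl | hr
  · exact summable_of_ne_finset_zero (s := {0}) fun b hb => by
      rw [zero_pow (by simpa using hb), mul_zero]
  · refine (((summable_nat_add_iff 1).2 (hw r)).mul_right r⁻¹).congr fun k => ?_
    field_simp
    ring

theorem norm_mul_tsum_le_exp {w : ℕ → ℂ} {a B : ℝ} (ha : 0 ≤ a)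
    (hw : ∀ k, ‖w k‖ ≤ B * (a ^ k / k.factorial)) (z : ℂ) :
    ‖z * ∑' j, w (j + 1) * z ^ j‖ ≤ B * Real.exp (a * ‖z‖) := by
  have hB : 0 ≤ B := by simpa using (norm_nonneg _).trans (hw 0)
  have hsum := (Real.summable_pow_div_factorial (a * ‖z‖)).mul_left B
  have hexp : ∑' k : ℕ, B * ((a * ‖z‖) ^ k / k.factorial) = B * Real.exp (a * ‖z‖) := by
    rw [tsum_mul_left, Real.exp_eq_exp_ℝ, NormedSpace.exp_eq_tsum_div]
  rw [← hexp, hsum.tsum_eq_zero_add, ← tsum_mul_left]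
  refine (tsum_of_norm_bounded ((summable_nat_add_iff 1).2 hsum).hasSum fun j => ?_).trans
    (le_add_of_nonneg_left
      (mul_nonneg hB (div_nonneg (pow_nonneg (mul_nonneg ha (norm_nonneg _)) _) (Nat.cast_nonneg _))))
  calc ‖z * (w (j + 1) * z ^ j)‖ = ‖w (j + 1)‖ * ‖z‖ ^ (j + 1) := by
        rw [norm_mul, norm_mul, norm_pow]; ring
    _ ≤ B * (a ^ (j + 1) / (j + 1).factorial) * ‖z‖ ^ (j + 1) :=
        mul_le_mul_of_nonneg_right (hw _) (by positivity)
    _ = B * ((a * ‖z‖) ^ (j + 1) / (j + 1).factorial) := by rw [mul_pow]; ring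

/-! ### Growth and vanishing of the transform -/

theorem tendsto_freeSymbol_cobounded :
    Tendsto freeSymbol (Bornology.cobounded ℂ) (Bornology.cobounded ℂ) := by
  rw [← tendsto_norm_atTop_iff_cobounded]
  refine tendsto_atTop_mono' _ ?_
    (tendsto_atTop_add_const_right _ (-3) tendsto_norm_cobounded_atTop)
  filter_upwards [tendsto_norm_cobounded_atTop.eventually_ge_atTop 1] with z hz
  have h1 : ‖z⁻¹‖ ≤ 1 := by rw [norm_inv]; exact inv_le_one_of_one_le₀ hz
  have h2 : ‖z‖ ≤ ‖freeSymbol z‖ + (2 + ‖z⁻¹‖) := by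
    have e : z = (2 - z⁻¹) - freeSymbol z := by rw [freeSymbol]; ring
    calc ‖z‖ = ‖(2 - z⁻¹) - freeSymbol z‖ := by rw [← e]
      _ ≤ ‖(2 : ℂ) - z⁻¹‖ + ‖freeSymbol z‖ := norm_sub_le _ _
      _ ≤ (‖(2 : ℂ)‖ + ‖z⁻¹‖) + ‖freeSymbol z‖ := by gcongr; exact norm_sub_le _ _
      _ = _ := by simp; ring
  linarith

theorem exists_radius_resolvent_freeSymbol (T : ℓ∞(A) →L[ℂ] ℓ∞(A)) :
    ∃ R : ℝ, 1 ≤ R ∧ ∀ z : ℂ, R ≤ ‖z‖ →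
      freeSymbol z ∈ resolventSet ℂ T ∧ ‖resolvent T (freeSymbol z)‖ ≤ 1 := by
  have h1 : ∀ᶠ z in Bornology.cobounded ℂ, ‖resolvent T (freeSymbol z)‖ < 1 :=
    ((spectrum.resolvent_tendsto_cobounded (𝕜 := ℂ) T).comp
      tendsto_freeSymbol_cobounded).norm.eventually_lt_const (by simp)
  have h2 : ∀ᶠ z in Bornology.cobounded ℂ,
      ‖T‖ * ‖(1 : ℓ∞(A) →L[ℂ] ℓ∞(A))‖ < ‖freeSymbol z‖ :=
    (tendsto_norm_cobounded_atTop.comp tendsto_freeSymbol_cobounded).eventually_gt_atTop _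
  obtain ⟨R, -, hR⟩ := (hasBasis_cobounded_norm (E := ℂ)).eventually_iff.1 (h1.and h2)
  exact ⟨max R 1, le_max_right _ _, fun z hz =>
    have h := hR (show z ∈ {x : ℂ | R ≤ ‖x‖} from (le_max_left _ _).trans hz)
    ⟨spectrum.mem_resolventSet_of_norm_lt_mul h.2, h.1.le⟩⟩

theorem differentiableAt_channelTransform {T : ℓ∞(A) →L[ℂ] ℓ∞(A)} {c : ℕ → A} {w : ℓ∞(A)}
    (hw : ∀ r : ℝ, Summable fun k => ‖w (c k)‖ * r ^ k) {z : ℂ} (hz : z ≠ 0)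
    (hres : freeSymbol z ∈ resolventSet ℂ T) :
    DifferentiableAt ℂ (channelTransform T c w) z := by
  have hS := (differentiable_tsum_pow (summable_norm_succ_mul_pow (w := fun k => w (c k)) hw)) z
  have hsym : DifferentiableAt ℂ freeSymbol z := by
    unfold freeSymbol
    exact ((differentiableAt_const _).sub differentiableAt_id).sub (differentiableAt_inv hz)
  have hR : DifferentiableAt ℂ (fun z => resolvent T (freeSymbol z)) z :=
    (spectrum.hasDerivAt_resolvent_const_left hres).differentiableAt.comp z hsym
  have hev : ∀ α : A, DifferentiableAt ℂ (fun z => resolvent T (freeSymbol z) w α) z := fun α =>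
    ((lp.evalCLM ℂ (fun _ : A => ℂ) ∞ α) ∘L
      (ContinuousLinearMap.apply ℂ ℓ∞(A) w)).differentiableAt.comp z hR
  exact ((differentiableAt_id.mul hS).sub (differentiableAt_id.mul (hev _))).add (hev _)

theorem norm_channelTransform_le {T : ℓ∞(A) →L[ℂ] ℓ∞(A)} {c : ℕ → A} {w : ℓ∞(A)} {a B : ℝ}
    (ha : 0 < a) (hw : ∀ k, ‖w (c k)‖ ≤ B * (a ^ k / k.factorial)) {z : ℂ}
    (hres : ‖resolvent T (freeSymbol z)‖ ≤ 1) :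
    ‖channelTransform T c w z‖ ≤ (B + (a⁻¹ + 1) * ‖w‖) * Real.exp (a * ‖z‖) := by
  have h1 := norm_mul_tsum_le_exp (w := fun k => w (c k)) ha.le hw z
  have h2 : ∀ α, ‖resolvent T (freeSymbol z) w α‖ ≤ ‖w‖ := fun α =>
    (norm_lp_top_apply_le _ _).trans ((ContinuousLinearMap.le_opNorm _ _).trans
      (mul_le_of_le_one_left (norm_nonneg _) hres))
  have h3 : ‖z‖ ≤ a⁻¹ * Real.exp (a * ‖z‖) := by
    rw [← div_eq_inv_mul, le_div_iff₀ ha]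
    linarith [Real.add_one_le_exp (a * ‖z‖)]
  have h4 : 1 ≤ Real.exp (a * ‖z‖) := Real.one_le_exp (by positivity)
  calc ‖channelTransform T c w z‖
      ≤ B * Real.exp (a * ‖z‖) + ‖z‖ * ‖w‖ + ‖w‖ := by
        refine (norm_add_le _ _).trans (add_le_add ((norm_sub_le _ _).trans (add_le_add h1 ?_)) (h2 _))
        rw [norm_mul]
        exact mul_le_mul_of_nonneg_left (h2 _) (norm_nonneg _)
    _ ≤ B * Real.exp (a * ‖z‖) + a⁻¹ * Real.exp (a * ‖z‖) * ‖w‖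
          + Real.exp (a * ‖z‖) * ‖w‖ := by
        gcongr
        exact le_mul_of_one_le_left (norm_nonneg _) h4
    _ = _ := by ring

/-- If the transform of `w` vanishes near infinity, the series `∑ w(c(j+1)) z ^ j` is a combination of
values of the resolvent, which tends to `0` at infinity. -/
theorem coeff_eq_zero_of_channelTransform_eq_zero {T : ℓ∞(A) →L[ℂ] ℓ∞(A)} {c : ℕ → A} {w : ℓ∞(A)}
    {R : ℝ} (hw : ∀ r : ℝ, Summable fun k => ‖w (c k)‖ * r ^ k) (hR : 1 ≤ R)
    (h0 : ∀ z : ℂ, R < ‖z‖ → channelTransform T c w z = 0) (k : ℕ) : w (c (k + 1)) = 0 := by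
  have hres : Tendsto (fun z : ℂ => resolvent T (freeSymbol z)) (Bornology.cobounded ℂ) (𝓝 0) :=
    (spectrum.resolvent_tendsto_cobounded (𝕜 := ℂ) T).comp tendsto_freeSymbol_cobounded
  have hev : ∀ α : A, Tendsto (fun z : ℂ => resolvent T (freeSymbol z) w α)
      (Bornology.cobounded ℂ) (𝓝 0) := fun α => by
    have := (((lp.evalCLM ℂ (fun _ : A => ℂ) ∞ α) ∘L
      (ContinuousLinearMap.apply ℂ ℓ∞(A) w)).continuous.tendsto 0).comp hres
    rw [map_zero] at this
    exact this
  have hlim : Tendsto (fun z : ℂ => ∑' j, w (c (j + 1)) * z ^ j) (Bornology.cobounded ℂ) (𝓝 0) := by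
    have h1 := (hev (c 0)).sub (tendsto_inv₀_cobounded.mul (hev (c 1)))
    rw [mul_zero, sub_zero] at h1
    refine h1.congr' ?_
    filter_upwards [tendsto_norm_cobounded_atTop.eventually_gt_atTop R] with z hz
    have hz0 : z ≠ 0 := norm_pos_iff.1 (by linarith)
    have h := h0 z hz
    rw [channelTransform] at h
    field_simp
    linear_combination -h
  exact congrFun (coeff_eq_zero_of_tendsto_zero
    (summable_norm_succ_mul_pow (w := fun k => w (c k)) hw) hlim) k

namespace IsFreeChannel

variable {M : A → A → ℂ} {c : ℕ → A} {T : ℓ∞(A) →L[ℂ] ℓ∞(A)}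

/-- Factorial decay of rate `a < 1 / 2` at the times `0` and `1` makes the transforms vanish near
infinity. -/
theorem channelTransform_eq_zero (hc : IsFreeChannel M c) {C : ℝ}
    (hs : ∀ α, Summable fun β => ‖M α β‖) (hM : ∀ α, ∑' β, ‖M α β‖ ≤ C)
    (hT : ∀ x α, T x α = ∑' β, M α β * x β) {w₀ w₁ : ℓ∞(A)}
    (hw : w₁ = NormedSpace.exp (Complex.I • T) w₀) {a B₀ B₁ : ℝ} (ha : 0 < a) (ha' : a < 1 / 2)
    (h₀ : ∀ k, ‖w₀ (c k)‖ ≤ B₀ * (a ^ k / k.factorial))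
    (h₁ : ∀ k, ‖w₁ (c k)‖ ≤ B₁ * (a ^ k / k.factorial)) :
    ∃ R : ℝ, 1 ≤ R ∧ ∀ z : ℂ, R < ‖z‖ →
      channelTransform T c w₀ z = 0 ∧ channelTransform T c w₁ z = 0 := by
  obtain ⟨R, hR, hres⟩ := exists_radius_resolvent_freeSymbol T
  have hne : ∀ z : ℂ, R ≤ ‖z‖ → z ≠ 0 := fun z hz => norm_pos_iff.1 (by linarith)
  have hs₀ := summable_mul_pow_of_le_div_factorial h₀
  have hexp : ∀ z : ℂ, R ≤ ‖z‖ → channelTransform T c w₁ z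
      = Complex.exp (Complex.I * freeSymbol z) * channelTransform T c w₀ z := fun z hz => by
    rw [hw, hc.channelTransform_exp hs hM hT hs₀ (hne z hz) (hres z hz).1]
  set D₀ := B₀ + (a⁻¹ + 1) * ‖w₀‖
  set D₁ := B₁ + (a⁻¹ + 1) * ‖w₁‖
  have hB₀ : 0 ≤ B₀ := by simpa using (norm_nonneg _).trans (h₀ 0)
  have hB₁ : 0 ≤ B₁ := by simpa using (norm_nonneg _).trans (h₁ 0)
  have hD₀ : 0 ≤ D₀ := by positivity
  have hD₁ : 0 ≤ D₁ := by positivity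
  have hrot : ∀ z : ℂ, ‖Complex.exp (-(Complex.I * z / 2))‖ = Real.exp (z.im / 2) := fun z => by
    rw [Complex.norm_exp]
    congr 1
    simp
    ring
  have hzero : ∀ z : ℂ, R < ‖z‖ → channelTransform T c w₀ z = 0 := by
    intro z hz
    have := eq_zero_of_exponential_decay_at_infinity (R := R) (a := a) (b := 1 / 2)
      (C := D₀ + D₁ * Real.exp 1)
      (f := fun z => channelTransform T c w₀ z * Complex.exp (-(Complex.I * z / 2)))
      ha' ha.le (by linarith)
      (fun z hz => (differentiableAt_channelTransform hs₀ (hne z hz) (hres z hz).1).mul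
        (by fun_prop))
      (fun z hz => by
        rw [norm_mul, hrot]
        -- In the lower half-plane the bound for `w₀` suffices; in the upper one the factor
        -- `exp (-i λ(z))`, of modulus about `exp (- Im z)`, improves the bound for `w₁`.
        rcases le_total z.im 0 with him | him
        · have h := norm_channelTransform_le ha h₀ (hres z hz).2
          calc _ ≤ D₀ * Real.exp (a * ‖z‖) * Real.exp (z.im / 2) := by gcongr
            _ = D₀ * Real.exp (a * ‖z‖ - 1 / 2 * |z.im|) := by
              rw [mul_assoc, ← Real.exp_add, abs_of_nonpos him]; ring_nf
            _ ≤ _ := by gcongr; exact le_add_of_nonneg_right (by positivity)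
        · have h := norm_channelTransform_le ha h₁ (hres z hz).2
          have hback : channelTransform T c w₀ z
              = Complex.exp (-(Complex.I * freeSymbol z)) * channelTransform T c w₁ z := by
            rw [hexp z hz, ← mul_assoc, ← Complex.exp_add, neg_add_cancel, Complex.exp_zero,
              one_mul]
          have hfac : ‖Complex.exp (-(Complex.I * freeSymbol z))‖ ≤ Real.exp (1 - z.im) := by
            rw [Complex.norm_exp]
            refine Real.exp_le_exp.2 ?_
            have h1 : |(z⁻¹).im| ≤ 1 := (Complex.abs_im_le_norm _).trans (by
              rw [norm_inv]; exact inv_le_one_of_one_le₀ (hR.trans hz))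
            have h2 := abs_le.1 h1
            have h3 : (-(Complex.I * freeSymbol z)).re = -z.im - (z⁻¹).im := by
              simp [freeSymbol]
              ring
            rw [h3]
            linarith
          rw [hback, norm_mul]
          calc _ ≤ Real.exp (1 - z.im) * (D₁ * Real.exp (a * ‖z‖)) * Real.exp (z.im / 2) := by
                gcongr
            _ = D₁ * (Real.exp (1 - z.im) * Real.exp (a * ‖z‖) * Real.exp (z.im / 2)) := by ring
            _ = D₁ * (Real.exp 1 * Real.exp (a * ‖z‖ - 1 / 2 * |z.im|)) := by
              rw [← Real.exp_add, ← Real.exp_add, ← Real.exp_add, abs_of_nonneg him]; ring_nf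
            _ = D₁ * Real.exp 1 * Real.exp (a * ‖z‖ - 1 / 2 * |z.im|) := by ring
            _ ≤ _ := by gcongr; exact le_add_of_nonneg_left hD₀)
      hz
    exact (mul_eq_zero.1 this).resolve_right (Complex.exp_ne_zero _)
  exact ⟨R, hR, fun z hz => ⟨hzero z hz, by rw [hexp z hz.le, hzero z hz, mul_zero]⟩⟩

theorem apply_eq_zero_of_decay (hc : IsFreeChannel M c) {C : ℝ}
    (hs : ∀ α, Summable fun β => ‖M α β‖) (hM : ∀ α, ∑' β, ‖M α β‖ ≤ C)
    (hT : ∀ x α, T x α = ∑' β, M α β * x β) {w₀ w₁ : ℓ∞(A)}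
    (hw : w₁ = NormedSpace.exp (Complex.I • T) w₀) {a : ℝ} (ha : 0 < a) (ha' : a < 1 / 2)
    (h₀ : (fun k => w₀ (c k)) =O[atTop] fun k : ℕ => a ^ k / k.factorial)
    (h₁ : (fun k => w₁ (c k)) =O[atTop] fun k : ℕ => a ^ k / k.factorial) (k : ℕ) :
    w₀ (c (k + 1)) = 0 ∧ w₁ (c (k + 1)) = 0 := by
  have hbd : ∀ w : ℓ∞(A), ((fun k => w (c k)) =O[atTop] fun k : ℕ => a ^ k / k.factorial) →
      ∃ B, ∀ k, ‖w (c k)‖ ≤ B * (a ^ k / k.factorial) := by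
    intro w h
    obtain ⟨B, -, hB⟩ := Asymptotics.bound_of_isBigO_nat_atTop h
    refine ⟨B, fun k => ?_⟩
    have hpos : 0 < a ^ k / (k.factorial : ℝ) := by positivity
    simpa only [Real.norm_of_nonneg hpos.le] using hB hpos.ne'
  obtain ⟨B₀, hB₀⟩ := hbd w₀ h₀
  obtain ⟨B₁, hB₁⟩ := hbd w₁ h₁
  obtain ⟨R, hR, h⟩ := hc.channelTransform_eq_zero hs hM hT hw ha ha' hB₀ hB₁
  exact ⟨coeff_eq_zero_of_channelTransform_eq_zero
      (summable_mul_pow_of_le_div_factorial hB₀) hR (fun z hz => (h z hz).1) k,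
    coeff_eq_zero_of_channelTransform_eq_zero
      (summable_mul_pow_of_le_div_factorial hB₁) hR (fun z hz => (h z hz).2) k⟩

/-- After one application of `apply_eq_zero_of_decay`, the vectors `T w` and `exp (i T) (T w)` vanish at
`c k` for `k ≥ 2`; in particular they decay, and the theorem applies to them again. -/
theorem pow_apply_eq_zero_of_decay (hc : IsFreeChannel M c) {C : ℝ}
    (hs : ∀ α, Summable fun β => ‖M α β‖) (hM : ∀ α, ∑' β, ‖M α β‖ ≤ C)
    (hT : ∀ x α, T x α = ∑' β, M α β * x β) (n : ℕ) {w : ℓ∞(A)} {a : ℝ} (ha : 0 < a)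
    (ha' : a < 1 / 2)
    (h₀ : (fun k => w (c k)) =O[atTop] fun k : ℕ => a ^ k / k.factorial)
    (h₁ : (fun k => NormedSpace.exp (Complex.I • T) w (c k)) =O[atTop]
      fun k : ℕ => a ^ k / k.factorial) (k : ℕ) :
    (T ^ n) w (c (k + 1)) = 0 := by
  induction n generalizing w k with
  | zero => exact (hc.apply_eq_zero_of_decay hs hM hT rfl ha ha' h₀ h₁ k).1
  | succ n ih =>
    have h := hc.apply_eq_zero_of_decay hs hM hT rfl ha ha' h₀ h₁
    have hcomm : NormedSpace.exp (Complex.I • T) (T w)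
        = T (NormedSpace.exp (Complex.I • T) w) :=
      (ContinuousLinearMap.comp_exp_of_comp_eq (φ := T) (fun y => by
        change T (Complex.I • T y) = Complex.I • T (T y)
        rw [map_smul]) w).symm
    have hvan : ∀ x : ℓ∞(A), (∀ k, x (c (k + 1)) = 0) →
        (fun k => T x (c k)) =O[atTop] fun k : ℕ => a ^ k / k.factorial := fun x hx => by
      refine EventuallyEq.trans_isBigO ?_ (Asymptotics.isBigO_zero _ _)
      filter_upwards [eventually_ge_atTop 2] with k hk
      obtain ⟨j, rfl⟩ := Nat.exists_eq_add_of_le' hk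
      rw [show j + 2 = (j + 1) + 1 from rfl, hc.apply_succ hT, hx (j + 1), hx j, hx (j + 2)]
      simp
    rw [pow_succ]
    exact ih (w := T w) (hvan _ fun k => (h k).1) (by rw [hcomm]; exact hvan _ fun k => (h k).2) k

end IsFreeChannel

/-- Stirling's upper bound `n! ≤ e √n (n / e) ^ n`, weakened to `e n (n / e) ^ n`. -/
theorem exp_one_div_pow_le_div_factorial {n : ℕ} (hn : 0 < n) :
    (Real.exp 1 / n) ^ n ≤ Real.exp 1 * n / n.factorial := by
  have hn' : (0 : ℝ) < n := Nat.cast_pos.2 hn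
  have hn1 : (1 : ℝ) ≤ n := Nat.one_le_cast.2 hn
  have h : Stirling.stirlingSeq n ≤ Real.exp 1 / √2 := by
    obtain ⟨m, rfl⟩ := Nat.exists_eq_succ_of_ne_zero hn.ne'
    have := Stirling.stirlingSeq'_antitone (Nat.zero_le m)
    simpa [Stirling.stirlingSeq_one] using this
  rw [Stirling.stirlingSeq, div_le_iff₀ (by positivity), Real.sqrt_mul (by norm_num)] at h
  have h2 : Real.exp 1 / √2 * (√2 * √n * (n / Real.exp 1) ^ n)
      = Real.exp 1 * √n * (n / Real.exp 1) ^ n := by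
    have : √(2 : ℝ) ≠ 0 := by positivity
    field_simp
  rw [h2] at h
  have h3 : √(n : ℝ) ≤ n := Real.sqrt_le_iff.2 ⟨hn'.le, by nlinarith⟩
  have h4 : (Real.exp 1 / n) ^ n * (n / Real.exp 1) ^ n = 1 := by
    rw [← mul_pow]
    have : Real.exp 1 / n * (n / Real.exp 1) = 1 := by field_simp
    rw [this, one_pow]
  rw [le_div_iff₀ (by positivity)]
  calc (Real.exp 1 / n) ^ n * n.factorial
      ≤ (Real.exp 1 / n) ^ n * (Real.exp 1 * √n * (n / Real.exp 1) ^ n) := by gcongr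
    _ = Real.exp 1 * √n * ((Real.exp 1 / n) ^ n * (n / Real.exp 1) ^ n) := by ring
    _ ≤ Real.exp 1 * n := by rw [h4, mul_one]; gcongr

/-- The decay rate `(e / ((2 + ε) k)) ^ k` is faster than `a ^ k / k!` for some `a < 1 / 2`, also after the
sequence is shifted. -/
theorem exists_isBigO_pow_div_factorial {ε : ℝ} (hε : 0 < ε) : ∃ a : ℝ, 0 < a ∧ a < 1 / 2 ∧
    ∀ (v : ℕ → ℂ) (C : ℝ) (K : ℕ),
      (∀ k : ℕ, 0 < k → ‖v k‖ ≤ C * (Real.exp 1 / ((2 + ε) * k)) ^ k) →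
      (fun k => v (K + k)) =O[atTop] fun k : ℕ => a ^ k / k.factorial := by
  set b : ℝ := 1 / (2 + ε) with hb
  have hb0 : 0 < b := by positivity
  have hb2 : b < 1 / 2 := one_div_lt_one_div_of_lt (by norm_num) (by linarith)
  obtain ⟨a, hba, ha⟩ := exists_between hb2
  refine ⟨a, hb0.trans hba, ha, fun v C K hv => ?_⟩
  have hpoly : (fun k : ℕ => ((K : ℝ) + k) * b ^ k) =O[atTop] fun k : ℕ => a ^ k := by
    have hlt : ‖b‖ < a := by rwa [Real.norm_of_nonneg hb0.le]
    have h0 := (isLittleO_pow_const_mul_const_pow_const_pow_of_norm_lt 0 hlt).isBigO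
    have h1 := (isLittleO_pow_const_mul_const_pow_const_pow_of_norm_lt 1 hlt).isBigO
    refine ((h0.const_mul_left (K : ℝ)).add h1).congr_left fun k => ?_
    simp only [pow_zero, pow_one]
    ring
  refine Asymptotics.IsBigO.trans (g := fun k : ℕ => (((K : ℝ) + k) * b ^ k) / k.factorial) ?_ ?_
  · refine Asymptotics.IsBigO.of_bound (|C| * Real.exp 1) ?_
    filter_upwards [eventually_gt_atTop 0] with k hk
    have hm : 0 < K + k := by omega
    rw [Real.norm_of_nonneg (by positivity)]
    calc ‖v (K + k)‖ ≤ |C| * (Real.exp 1 / ((2 + ε) * (K + k : ℕ))) ^ (K + k) :=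
          (hv _ hm).trans (by gcongr; exact le_abs_self C)
      _ = |C| * (b ^ (K + k) * (Real.exp 1 / (K + k : ℕ)) ^ (K + k)) := by
          rw [← mul_pow, hb, div_mul_div_comm, one_mul]
      _ ≤ |C| * (b ^ k * (Real.exp 1 * (K + k : ℕ) / k.factorial)) := by
          gcongr ?_ * (?_ * ?_)
          · exact pow_le_pow_of_le_one hb0.le (by linarith) (by omega)
          · refine (exp_one_div_pow_le_div_factorial hm).trans ?_
            gcongr
            omega
      _ = |C| * Real.exp 1 * ((((K : ℝ) + k) * b ^ k) / k.factorial) := by push_cast; ring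
  · simp only [div_eq_mul_inv]
    exact hpoly.mul (Asymptotics.isBigO_refl _ _)

/-! ### The interaction matrix of a multichannel system -/

namespace MultichannelSystem

variable {Γ : Type*} (S : MultichannelSystem A Γ)

theorem L_comm (α β : A) : S.L α β = S.L β α := by
  simpa using (S.posSemidef.1.apply α β).symm

theorem channel_injective_of_pos (ν : Γ) {K : ℕ} (hK : 0 < K) :
    Function.Injective fun k => S.channel ν (K + k) := fun j k h => by
  have := (S.channel_inj ν ν (K + j) (K + k) (by omega) h).2
  omega

theorem channel_mem_core_iff {ν : Γ} {k : ℕ} (hk : 1 ≤ k) : S.channel ν k ∈ S.core ↔ k = 1 := by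
  constructor
  · rintro (h | ⟨σ, h⟩)
    · exact absurd ⟨ν, k, hk, rfl⟩ h
    · exact (S.channel_inj ν σ k 1 hk h).2
  · rintro rfl
    exact Or.inr ⟨ν, rfl⟩

theorem exists_channel_of_notMem_core {γ : A} (hγ : γ ∉ S.core) :
    ∃ ν k, γ = S.channel ν (k + 2) := by
  have h : γ ∈ S.outer := by
    by_contra h
    exact hγ (Or.inl h)
  obtain ⟨ν, k, hk, rfl⟩ := h
  have hk1 : k ≠ 1 := fun h => hγ ((S.channel_mem_core_iff hk).2 h)
  exact ⟨ν, k - 2, by congr 1; omega⟩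

/-- The only interactions between the core and its complement are those of `ν(1)` with `ν(2)`. -/
theorem eq_channel_two_of_interact {β γ : A} (hβ : β ∈ S.core) (hγ : γ ∉ S.core)
    (h : S.L β γ ≠ 0) : ∃ ν, β = S.channel ν 1 ∧ γ = S.channel ν 2 := by
  obtain ⟨ν, k, rfl⟩ := S.exists_channel_of_notMem_core hγ
  rw [S.L_comm] at h
  rcases S.channel_no_other ν (k + 1) β h with rfl | rfl | rfl
  · have := (S.channel_mem_core_iff (by omega)).1 hβ
    obtain rfl : k = 0 := by omega
    exact ⟨ν, rfl, rfl⟩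
  all_goals
    have := (S.channel_mem_core_iff (by omega)).1 hβ
    omega

theorem finite_row [Finite Γ] (α : A) : {β | S.L α β ≠ 0}.Finite := by
  by_cases hα : α ∈ S.outer
  · obtain ⟨ν, k, hk, rfl⟩ := hα
    obtain ⟨j, rfl⟩ := Nat.exists_eq_add_of_le' hk
    exact (Set.toFinite {S.channel ν j, S.channel ν (j + 1), S.channel ν (j + 2)}).subset
      fun β hβ => by simpa using S.channel_no_other ν j β hβ
  · refine (Set.toFinite S.core).subset fun β hβ => ?_
    by_contra h
    obtain ⟨ν, rfl, -⟩ := S.eq_channel_two_of_interact (Or.inl hα) h hβ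
    exact hα ⟨ν, 1, le_rfl, rfl⟩

theorem summable_norm_row [Finite Γ] (α : A) : Summable fun β => ‖(S.L α β : ℂ)‖ :=
  summable_of_hasFiniteSupport ((S.finite_row α).subset fun β hβ => by simpa using hβ)

theorem isFreeChannel {K : ℕ} (hK : 0 < K) (ν : Γ)
    (hS : ∀ k, K ≤ k → S.L (S.channel ν k) (S.channel ν k) = 2 ∧
      - S.L (S.channel ν k) (S.channel ν (k + 1)) = 1) :
    IsFreeChannel (fun α β => (S.L α β : ℂ)) fun k => S.channel ν (K + k) where
  injective := S.channel_injective_of_pos ν hK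
  band k β h := S.channel_no_other ν (K + k) β (by exact_mod_cast h)
  diag k := by rw [(hS _ (by omega)).1]; norm_num
  prev k := by
    rw [S.L_comm]
    have := (hS (K + k) (by omega)).2
    rw [neg_eq_iff_eq_neg] at this
    rw [show K + (k + 1) = K + k + 1 from rfl, this]; norm_num
  next k := by
    have := (hS (K + (k + 1)) (by omega)).2
    rw [neg_eq_iff_eq_neg] at this
    rw [show K + (k + 2) = K + (k + 1) + 1 from rfl, this]; norm_num

theorem exists_row_sum_le [Finite Γ] : ∃ C : ℝ, 0 ≤ C ∧ ∀ α, ∑' β, ‖(S.L α β : ℂ)‖ ≤ C := by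
  classical
  obtain ⟨K, hK, hS⟩ := S.stabilized
  have hfin : (S.inner ∪ Set.range fun p : Γ × Fin (K + 1) => S.channel p.1 p.2).Finite :=
    S.finite_compl.union (Set.finite_range _)
  obtain ⟨C, hC⟩ := (hfin.image fun α => ∑' β, ‖(S.L α β : ℂ)‖).bddAbove
  refine ⟨max C 4, by positivity, fun α => ?_⟩
  by_cases hα : α ∈ S.inner ∪ Set.range fun p : Γ × Fin (K + 1) => S.channel p.1 p.2
  · exact (hC ⟨α, hα, rfl⟩).trans (le_max_left _ _)
  · refine le_trans ?_ (le_max_right _ _)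
    rw [Set.mem_union, not_or] at hα
    obtain ⟨ν, k, hk, rfl⟩ : α ∈ S.outer := not_not.1 hα.1
    have hkK : K < k := by
      by_contra h
      exact hα.2 ⟨(ν, ⟨k, by omega⟩), rfl⟩
    obtain ⟨j, rfl⟩ : ∃ j, k = K + (j + 1) := ⟨k - K - 1, by omega⟩
    have hc := S.isFreeChannel hK ν (hS ν)
    rw [tsum_eq_sum (s := {S.channel ν (K + j), S.channel ν (K + (j + 1)),
      S.channel ν (K + (j + 2))})]
    · have hne : ∀ {i k : ℕ}, i ≠ k → S.channel ν (K + i) ≠ S.channel ν (K + k) :=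
        fun h => hc.injective.ne h
      rw [Finset.sum_insert (by simp [hne]), Finset.sum_pair (hne (by omega)),
        hc.diag j, hc.prev j, hc.next j]
      norm_num
    · intro β hβ
      by_contra h
      have := hc.band j β (by simpa using h)
      simp at hβ
      tauto

end MultichannelSystem

/-! ### Propagation of zeros -/

/-- If all `T ^ n w` vanish at `β` and at all points that interact with `β` except for `α`, then they vanish
at `α`: evaluate `T ^ (n + 1) w = T (T ^ n w)` at `β`. -/
theorem eq_zero_of_pow_apply_eq_zero {M : A → A → ℂ} {T : ℓ∞(A) →L[ℂ] ℓ∞(A)}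
    (hT : ∀ x α, T x α = ∑' β, M α β * x β) {w : ℓ∞(A)} {α β : A}
    (hβ : ∀ n, (T ^ n) w β = 0) (hM : M β α ≠ 0)
    (h : ∀ γ, γ ≠ α → M β γ ≠ 0 → ∀ n, (T ^ n) w γ = 0) (n : ℕ) : (T ^ n) w α = 0 := by
  have h1 := hβ (n + 1)
  rw [pow_succ', mul_apply_eq_comp, hT, tsum_eq_single α fun γ hγ => ?_] at h1
  · exact (mul_eq_zero.1 h1).resolve_left hM
  · by_cases hM' : M β γ = 0
    · rw [hM', zero_mul]
    · rw [h γ hγ hM' n, mul_zero]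

theorem exists_lp_two_to_top : ∃ J : lp (fun _ : A => ℂ) 2 →L[ℂ] ℓ∞(A), ∀ x α, J x α = x α :=
  ⟨LinearMap.mkContinuous
    { toFun := fun x => ⟨x, (lp.memℓp x).of_exponent_ge le_top⟩
      map_add' := fun _ _ => rfl
      map_smul' := fun _ _ => rfl } 1 fun x =>
    lp.norm_le_of_forall_le (by positivity) fun α => by
      rw [one_mul]
      exact lp.norm_apply_le_norm (by simp) x α, fun _ _ => rfl⟩

namespace MultichannelSystem

variable {Γ : Type*} (S : MultichannelSystem A Γ)

theorem IsSolution.eq_exp {S : MultichannelSystem A Γ} {u : ℝ → lp (fun _ : A => ℂ) 2}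
    (hu : S.IsSolution u) {T : ℓ∞(A) →L[ℂ] ℓ∞(A)}
    (hT : ∀ x α, T x α = ∑' β, (S.L α β : ℂ) * x β)
    {J : lp (fun _ : A => ℂ) 2 →L[ℂ] ℓ∞(A)} (hJ : ∀ x α, J x α = x α)
    {t : ℝ} (ht : t ∈ Set.Icc (0 : ℝ) 1) :
    J (u t) = NormedSpace.exp ((t : ℂ) • (Complex.I • T)) (J (u 0)) := by
  refine eq_exp_of_hasDerivWithinAt (W := fun t => J (u t)) (fun t ht => ?_) ht
  have h := ((hu.1.differentiableOn (by simp)) t ht).hasDerivWithinAt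
  have hJd := (J.restrictScalars ℝ).hasFDerivAt.comp_hasDerivWithinAt t h
  have heq : (Complex.I • T) (J (u t)) = J (derivWithin u (Set.Icc 0 1) t) := by
    ext α
    have h1 := ((lp.evalCLM ℂ (fun _ : A => ℂ) 2 α).restrictScalars
      ℝ).hasFDerivAt.comp_hasDerivWithinAt t h
    have h2 := (uniqueDiffOn_Icc zero_lt_one t ht).eq_deriv _ h1 (hu.2 t ht α)
    change Complex.I * T (J (u t)) α = J _ α
    rw [hT, hJ]
    simp only [hJ]
    exact h2.symm
  rw [heq]
  exact hJd

theorem channel_vanish_down {T : ℓ∞(A) →L[ℂ] ℓ∞(A)}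
    (hT : ∀ x α, T x α = ∑' β, (S.L α β : ℂ) * x β) {w : ℓ∞(A)} (ν : Γ) (K : ℕ)
    (h : ∀ k, K ≤ k → ∀ n, (T ^ n) w (S.channel ν k) = 0) (k n : ℕ) :
    (T ^ n) w (S.channel ν k) = 0 := by
  induction K with
  | zero => exact h k (by omega) n
  | succ K ih =>
    refine ih fun k hk => ?_
    rcases hk.eq_or_lt with rfl | hk
    · refine eq_zero_of_pow_apply_eq_zero hT (h (K + 1) le_rfl)
        (by rw [S.L_comm]; exact_mod_cast S.channel_interact ν K) fun γ hγ hL => ?_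
      rcases S.channel_no_other ν K γ (by exact_mod_cast hL) with rfl | rfl | rfl
      · exact absurd rfl hγ
      · exact h _ le_rfl
      · exact h _ (by omega)
    · exact h k hk

theorem channel_vanish_up {T : ℓ∞(A) →L[ℂ] ℓ∞(A)}
    (hT : ∀ x α, T x α = ∑' β, (S.L α β : ℂ) * x β) {w : ℓ∞(A)} (ν : Γ)
    (h0 : ∀ n, (T ^ n) w (S.channel ν 0) = 0) (h1 : ∀ n, (T ^ n) w (S.channel ν 1) = 0) (k : ℕ) :
    ∀ n, (T ^ n) w (S.channel ν k) = 0 := by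
  induction k using Nat.strong_induction_on with
  | _ k ih =>
    match k, ih with
    | 0, _ => exact h0
    | 1, _ => exact h1
    | k + 2, ih =>
      refine eq_zero_of_pow_apply_eq_zero hT (ih (k + 1) (by omega))
        (by exact_mod_cast S.channel_interact ν (k + 1)) fun γ hγ hL => ?_
      rcases S.channel_no_other ν k γ (by exact_mod_cast hL) with rfl | rfl | rfl
      · exact ih _ (by omega)
      · exact ih _ (by omega)
      · exact absurd rfl hγ

/-- Zeros propagate along extensions within the core. A vertex of the core has all its neighbours in
the core, with the exception of `ν(1)`, which interacts with `ν(2)`. For `ν ≠ ν₀` the point `ν(2)`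
carries a zero anyway. The vertex `ν₀(1)` never produces an extension: it can only be reached from
`ν₀(0)`, which is its only neighbour in the core; the second part of the statement records this. -/
theorem vanish_of_extension {T : ℓ∞(A) →L[ℂ] ℓ∞(A)}
    (hT : ∀ x α, T x α = ∑' β, (S.L α β : ℂ) * x β) {w : ℓ∞(A)} (ν₀ : Γ)
    (hν : ∀ ν, ν ≠ ν₀ → ∀ k n, (T ^ n) w (S.channel ν k) = 0) {B : Set S.core}
    (hB : Relation.ReflTransGen (IsExtension (S.graph.induce S.core)) (S.channelStarts ν₀) B) :
    (∀ α ∈ B, ∀ n, (T ^ n) w (α : A) = 0) ∧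
      ∀ α ∈ B, (α : A) = S.channel ν₀ 1 → ∃ β ∈ B, (β : A) = S.channel ν₀ 0 := by
  induction hB with
  | refl =>
    refine ⟨?_, ?_⟩
    · rintro α ⟨ν, hne, h | h⟩ n <;> rw [h] <;> exact hν ν hne _ n
    · rintro α ⟨ν, hne, h | h⟩ h1 <;>
        exact absurd (S.channel_inj ν₀ ν 1 _ le_rfl (h1.symm.trans h)).1.symm hne
  | @tail B₁ _ _ hext ih =>
    obtain ⟨hvan, hstart⟩ := ih
    obtain ⟨β, hβ, α, ⟨hαB, hadj⟩, huniq, rfl⟩ := hext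
    have hadj' : (α : A) ≠ β ∧ S.L α β ≠ 0 := hadj
    refine ⟨?_, ?_⟩
    · rintro γ (hγ | rfl)
      · exact hvan γ hγ
      refine eq_zero_of_pow_apply_eq_zero hT (hvan β hβ)
        (by rw [S.L_comm]; exact_mod_cast hadj'.2) fun δ hδ hL => ?_
      have hL' : S.L β δ ≠ 0 := by exact_mod_cast hL
      by_cases hδc : δ ∈ S.core
      · by_cases hδB : (⟨δ, hδc⟩ : S.core) ∈ B₁
        · exact hvan _ hδB
        · have hne : δ ≠ β := fun h => hδB (by simpa [h] using hβ)
          have := huniq ⟨δ, hδc⟩ ⟨hδB, ⟨hne, by rwa [S.L_comm]⟩⟩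
          exact absurd (congrArg Subtype.val this) hδ
      · obtain ⟨ν, hβν, rfl⟩ := S.eq_channel_two_of_interact β.2 hδc hL'
        by_cases hne : ν = ν₀
        · subst hne
          exfalso
          obtain ⟨β₀, hβ₀, hβ₀'⟩ := hstart β hβ hβν
          have h1 := hadj'.2
          rw [S.L_comm, hβν] at h1
          rcases S.channel_no_other ν 0 γ h1 with h | h | h
          · exact hαB (by rwa [Subtype.ext (h.trans hβ₀'.symm)])
          · exact hadj'.1 (h.trans hβν.symm)
          · exact hδc (h ▸ γ.2)
        · exact hν ν hne 2
    · rintro γ (hγ | rfl) h1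
      · obtain ⟨β', hβ', h⟩ := hstart γ hγ h1
        exact ⟨β', Or.inl hβ', h⟩
      · have h2 := hadj'.2
        rw [h1] at h2
        rcases S.channel_no_other ν₀ 0 β h2 with h | h | h
        · exact ⟨β, Or.inl hβ, h⟩
        · exact absurd (h1.trans h.symm) hadj'.1
        · have := (S.channel_mem_core_iff (by omega)).1 (h ▸ β.2 : S.channel ν₀ (0 + 2) ∈ S.core)
          omega

end MultichannelSystem

end Auxiliary

theorem corollary4p6 {A Γ : Type*} [Finite Γ] (S : MultichannelSystem A Γ)
    (u : ℝ → lp (fun _ : A => ℂ) 2) (hu : S.IsSolution u) (ν₀ : Γ)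
    (hdecay : ∀ ν, ν ≠ ν₀ → ∃ ε : ℝ, 0 < ε ∧ ∃ C : ℝ, ∀ k : ℕ, 0 < k →
      ∀ t ∈ ({0, 1} : Set ℝ),
        ‖u t (S.channel ν k)‖ ≤ C * (Real.exp 1 / ((2 + ε) * k)) ^ k)
    (hext : maximalExtension (S.graph.induce S.core) (S.channelStarts ν₀) = Set.univ) :
    ∀ t ∈ Set.Icc (0 : ℝ) 1, ∀ α : A, u t α = 0 := by
  obtain ⟨C, hC, hM⟩ := S.exists_row_sum_le
  obtain ⟨T, hT⟩ := exists_clm_of_kernel hC S.summable_norm_row hM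
  obtain ⟨J, hJ⟩ := exists_lp_two_to_top (A := A)
  obtain ⟨K, hK, hS⟩ := S.stabilized
  have hu1 : J (u 1) = NormedSpace.exp (Complex.I • T) (J (u 0)) := by
    simpa using hu.eq_exp hT hJ (Set.right_mem_Icc.2 zero_le_one)
  have hν : ∀ ν, ν ≠ ν₀ → ∀ k n, (T ^ n) (J (u 0)) (S.channel ν k) = 0 := by
    intro ν hne
    obtain ⟨ε, hε, B, hB⟩ := hdecay ν hne
    obtain ⟨a, ha, ha', hO⟩ := exists_isBigO_pow_div_factorial hε
    refine S.channel_vanish_down hT ν (K + 1) fun k hk n => ?_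
    obtain ⟨j, rfl⟩ : ∃ j, k = K + (j + 1) := ⟨k - K - 1, by omega⟩
    refine (S.isFreeChannel hK ν (hS ν)).pow_apply_eq_zero_of_decay S.summable_norm_row hM hT n
      ha ha' ?_ ?_ j
    · simp only [hJ]
      exact hO (fun k => u 0 (S.channel ν k)) B K fun k hk => hB k hk 0 (by simp)
    · simp only [← hu1, hJ]
      exact hO (fun k => u 1 (S.channel ν k)) B K fun k hk => hB k hk 1 (by simp)
  have hmax : IsMaximalExtension (S.graph.induce S.core) (S.channelStarts ν₀) Set.univ :=
    hext ▸ (existsUnique_isMaximalExtension (S.graph.induce S.core)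
      (S.channelStarts ν₀)).choose_spec.1
  obtain ⟨hvan, hstart⟩ := S.vanish_of_extension hT ν₀ hν hmax.1
  have hcore : ∀ α ∈ S.core, ∀ n, (T ^ n) (J (u 0)) α = 0 := fun α hα => hvan ⟨α, hα⟩ trivial
  have hch : ∀ ν k n, (T ^ n) (J (u 0)) (S.channel ν k) = 0 := by
    intro ν
    by_cases hne : ν = ν₀
    · subst hne
      have h1 : S.channel ν 1 ∈ S.core := Or.inr ⟨ν, rfl⟩
      obtain ⟨β, -, hβ⟩ := hstart ⟨_, h1⟩ trivial rfl
      exact S.channel_vanish_up hT ν (hβ ▸ hcore β β.2) (hcore _ h1)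
    · exact hν ν hne
  have hzero : J (u 0) = 0 := by
    ext α
    by_cases hα : α ∈ S.core
    · simpa using hcore α hα 0
    · obtain ⟨ν, k, rfl⟩ := S.exists_channel_of_notMem_core hα
      simpa using hch ν (k + 2) 0
  intro t ht α
  rw [← hJ, hu.eq_exp hT hJ ht, hzero, map_zero]
  rfl
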